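/- For a $C^*$-algebra $A$ and elements $a_1,\dots,a_k\in A$, let $C^*(a_1,\dots,a_k)$ denote the (not necessarily unital) sub-$C^*$-algebra of $A$ generated by $a_1,\dots,a_k$. If $A$ is unital, its generator rank $\mathrm{gr}(A)$ is the smallest integer $k\ge 0$ such that the set of tuples $(a_0,\dots,a_k)\in (A_{\mathrm{sa}})^{k+1}$ with $C^*(a_0,\dots,a_k)=A$ is norm-dense in $(A_{\mathrm{sa}})^{k+1}$, where $A_{\mathrm{sa}}$ is the set of self-adjoint elements of $A$; if no such $k$ exists, $\mathrm{gr}(A)=\infty$. If $A$ is not unital, $\mathrm{gr}(A):=\mathrm{gr}(\widetilde A)$, where $\widetilde A$ is the minimal unitization of $A$. An AF-algebra is a (not necessarily unital) $C^*$-algebra that is an inductive limit of finite-dimensional $C^*$-algebras; equivalently, it has an upward directed family of finite-dimensional sub-$C^*$-algebras whose union is dense. Corollary. Let $A$ be a separable AF-algebra. Then $\mathrm{gr}(A)\le 1$. Moreover, the set of single generators $\{a\in A : C^*(a)=A\}$ is a dense $G_\delta$-subset of $A$. -/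

import Mathlib

namespace CStarGen

/-- The sub-C⋆-algebra of `A` generated by a subset `s` (not required to contain a unit of `A`):
the closure of the ⋆-subalgebra generated by `s`. -/
def generatedBy {A : Type*} [NonUnitalCStarAlgebra A] (s : Set A) : NonUnitalStarSubalgebra ℂ A :=
  (NonUnitalStarAlgebra.adjoin ℂ s).topologicalClosure

/-- The set of generating self-adjoint `k`-tuples of `A`, inside the space of all self-adjoint
`k`-tuples (with the maximum norm). -/
def genSA (A : Type*) [NonUnitalCStarAlgebra A] (k : ℕ) : Set (Fin k → selfAdjoint A) :=
  {a | generatedBy (Set.range fun i => (a i : A)) = ⊤}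

/-- The smallest `k ≥ 0` such that the generating self-adjoint `(k+1)`-tuples of `A` are dense
in all self-adjoint `(k+1)`-tuples of `A`, and `⊤` if there is no such `k`. -/
noncomputable def grSA (A : Type*) [NonUnitalCStarAlgebra A] : ℕ∞ :=
  sInf {n : ℕ∞ | ∃ k : ℕ, n = k ∧ Dense (genSA A (k + 1))}

/-- `A` has a multiplicative unit. -/
def HasUnit (A : Type*) [NonUnitalCStarAlgebra A] : Prop :=
  ∃ e : A, ∀ a : A, e * a = a ∧ a * e = a

open Classical in
/-- The generator rank: computed in `A` itself if `A` is unital, and in the (minimal)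
unitization of `A` otherwise. -/
noncomputable def generatorRank (A : Type*) [NonUnitalCStarAlgebra A] : ℕ∞ :=
  if HasUnit A then grSA A else grSA (Unitization ℂ A)

/-- `A` is an AF-algebra: there is an upward directed family of finite-dimensional
sub-C⋆-algebras of `A` with dense union, that is, `A` is an inductive limit of
finite-dimensional C⋆-algebras. (Finite-dimensional ⋆-subalgebras are automatically closed.) -/
def IsAF (A : Type*) [NonUnitalCStarAlgebra A] : Prop :=
  ∃ F : Set (NonUnitalStarSubalgebra ℂ A),
    DirectedOn (· ≤ ·) F ∧ (∀ B ∈ F, FiniteDimensional ℂ B) ∧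
      Dense (⋃ B ∈ F, (B : Set A))

end CStarGen

namespace CStarGen

open Filter Topology

/-! By Baire, it is enough that for each `d` in a countable dense set and each `ε > 0` the open set
`approxGen d ε` is dense. In an AF-algebra this reduces to density of single generators in a
finite-dimensional `B`. There, `B` is semisimple, hence a product of matrix algebras, and has two
algebra generators. Generation by a pair follows from a determinant being nonzero; along an entire
curve of pairs this determinant is entire, so one generating pair on the curve gives generating
pairs at real parameters arbitrarily near 0 (`eventually_adjoin_eq_top`). Real and imaginary parts
turn self-adjoint pairs into single elements, which also gives the rank bound. -/

/-- The radical is nilpotent, and by the C⋆-identity a nilpotent `star x * x` vanishes. -/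
theorem isSemisimpleRing_of_finiteDimensional (B : Type*) [CStarAlgebra B]
    [FiniteDimensional ℂ B] : IsSemisimpleRing B := by
  have : IsArtinianRing B := IsArtinianRing.of_finite ℂ B
  rw [IsArtinianRing.isSemisimpleRing_iff_jacobson, eq_bot_iff]
  intro x hx
  obtain ⟨n, hn⟩ := IsSemiprimaryRing.isNilpotent (R := B)
  have hmem : star x * x ∈ Ring.jacobson B := Ideal.mul_mem_left _ _ hx
  -- The norm is multiplicative on `2 ^ n`-th powers of self-adjoint elements, hence this exponent.
  have hpow : (star x * x) ^ (2 ^ n) = 0 := by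
    have h : (star x * x) ^ n = 0 := by
      have := Ideal.pow_mem_pow hmem n
      rwa [hn] at this
    exact pow_eq_zero_of_le Nat.lt_two_pow_self.le h
  have hnorm := (IsSelfAdjoint.star_mul_self x).norm_pow_two_pow n
  rw [hpow, norm_zero] at hnorm
  have h0 : star x * x = 0 := norm_eq_zero.mp (pow_eq_zero_iff (by positivity) |>.mp hnorm.symm)
  simpa using CStarRing.star_mul_self_eq_zero_iff x |>.mp h0

theorem exists_adjoin_pair_pi_matrix {ι : Type*} [Fintype ι] [DecidableEq ι] (d : ι → ℕ) :
    ∃ x y : Π i, Matrix (Fin (d i)) (Fin (d i)) ℂ, Algebra.adjoin ℂ {x, y} = ⊤ := by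
  classical
  -- Diagonal entries distinct across all blocks: Lagrange interpolation in `x` isolates each
  -- diagonal matrix unit, and the all-ones `y` connects those within a block.
  obtain ⟨c, hc⟩ : ∃ c : (Σ i, Fin (d i)) → ℂ, Function.Injective c :=
    ⟨fun k => (Fintype.equivFin _ k : ℕ), fun a b h => by
      simp_all [Fin.val_inj]⟩
  let x : Π i, Matrix (Fin (d i)) (Fin (d i)) ℂ := fun i => Matrix.diagonal fun j => c ⟨i, j⟩
  let y : Π i, Matrix (Fin (d i)) (Fin (d i)) ℂ := fun i => Matrix.of fun _ _ => 1
  refine ⟨x, y, ?_⟩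
  set S := Algebra.adjoin ℂ {x, y}
  have hx : x ∈ S := Algebra.subset_adjoin (by simp)
  have hy : y ∈ S := Algebra.subset_adjoin (by simp)
  have haeval (p : Polynomial ℂ) (i : ι) :
      Polynomial.aeval x p i = Matrix.diagonal fun j => p.eval (c ⟨i, j⟩) := by
    have h1 : Polynomial.aeval x p i = Polynomial.aeval (x i) p :=
      (Polynomial.aeval_algHom_apply
        (Pi.evalAlgHom ℂ (fun i => Matrix (Fin (d i)) (Fin (d i)) ℂ) i) x p).symm
    have h2 : x i = Matrix.diagonalAlgHom ℂ (fun j => c ⟨i, j⟩) := rfl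
    rw [h1, h2, Polynomial.aeval_algHom_apply, Matrix.diagonalAlgHom_apply]
    congr 1
    funext j
    simp
  have hE (i : ι) (j : Fin (d i)) : Pi.single i (Matrix.single j j (1 : ℂ)) ∈ S := by
    let p := Lagrange.basis Finset.univ c ⟨i, j⟩
    have hp : Polynomial.aeval x p = Pi.single i (Matrix.single j j (1 : ℂ)) := by
      funext i'
      rw [haeval]
      by_cases hi : i' = i
      · subst hi
        rw [Pi.single_eq_same, ← Matrix.diagonal_single]
        congr 1
        funext j'
        by_cases hj : j' = j
        · subst hj
          simp [p, Lagrange.eval_basis_self hc.injOn]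
        · rw [Pi.single_eq_of_ne hj]
          exact Lagrange.eval_basis_of_ne (by simpa using Ne.symm hj) (Finset.mem_univ _)
      · rw [Pi.single_eq_of_ne hi, ← Matrix.diagonal_zero]
        congr 1
        funext j'
        refine Lagrange.eval_basis_of_ne ?_ (Finset.mem_univ _)
        intro h
        exact hi (congrArg Sigma.fst h).symm
    rw [← hp]
    exact Polynomial.aeval_mem_adjoin_singleton ℂ x |> fun h =>
      Algebra.adjoin_mono (by simp) h
  have hunit (i : ι) (j k : Fin (d i)) : Pi.single i (Matrix.single j k (1 : ℂ)) ∈ S := by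
    have h := mul_mem (mul_mem (hE i j) hy) (hE i k)
    convert h using 1
    funext i'
    by_cases hi : i' = i
    · subst hi
      simp [y, Matrix.single_mul_mul_single]
    · simp [Pi.single_eq_of_ne hi]
  rw [eq_top_iff]
  intro z _
  rw [← Finset.univ_sum_single z]
  refine sum_mem fun i _ => ?_
  let φ := LinearMap.single ℂ (fun i => Matrix (Fin (d i)) (Fin (d i)) ℂ) i
  change φ (z i) ∈ S
  rw [Matrix.matrix_eq_sum_single (z i), map_sum]
  refine sum_mem fun j _ => ?_
  rw [map_sum]
  refine sum_mem fun k _ => ?_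
  rw [← mul_one (z i j k), ← smul_eq_mul, ← Matrix.smul_single, map_smul]
  exact S.smul_mem (hunit i j k) _

theorem exists_algebra_adjoin_pair (B : Type*) [CStarAlgebra B] [FiniteDimensional ℂ B] :
    ∃ x y : B, Algebra.adjoin ℂ {x, y} = ⊤ := by
  have := isSemisimpleRing_of_finiteDimensional B
  obtain ⟨n, d, -, ⟨e⟩⟩ := IsSemisimpleRing.exists_algEquiv_pi_matrix_of_isAlgClosed ℂ B
  obtain ⟨x, y, h⟩ := exists_adjoin_pair_pi_matrix d
  refine ⟨e.symm x, e.symm y, ?_⟩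
  have := AlgHom.map_adjoin (e.symm : _ →ₐ[ℂ] B) {x, y}
  rw [h, Set.image_pair, Algebra.map_top, (AlgHom.range_eq_top _).mpr e.symm.surjective] at this
  exact this.symm

theorem exists_nonUnital_adjoin_pair (B : Type*) [NonUnitalCStarAlgebra B]
    [FiniteDimensional ℂ B] : ∃ x y : B, NonUnitalAlgebra.adjoin ℂ {x, y} = ⊤ := by
  have : FiniteDimensional ℂ (Unitization ℂ B) :=
    Module.Finite.equiv (Unitization.linearEquiv ℂ ℂ B).symm
  obtain ⟨x, y, h⟩ := exists_algebra_adjoin_pair (Unitization ℂ B)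
  refine ⟨x.snd, y.snd, ?_⟩
  set N := NonUnitalAlgebra.adjoin ℂ {x.snd, y.snd}
  have hx : x.snd ∈ N := NonUnitalAlgebra.subset_adjoin ℂ (by simp)
  have hy : y.snd ∈ N := NonUnitalAlgebra.subset_adjoin ℂ (by simp)
  have key : ∀ z ∈ Algebra.adjoin ℂ {x, y}, z.snd ∈ N := by
    intro z hz
    induction hz using Algebra.adjoin_induction with
    | mem z hz => rcases hz with rfl | rfl <;> assumption
    | algebraMap r => simp [Unitization.algebraMap_eq_inl]
    | add a b _ _ ha hb => simpa using add_mem ha hb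
    | mul a b _ _ ha hb =>
      rw [Unitization.snd_mul]
      exact add_mem (add_mem (SMulMemClass.smul_mem _ hb) (SMulMemClass.smul_mem _ ha)) (mul_mem ha hb)
  rw [eq_top_iff]
  intro b _
  simpa using key (b : Unitization ℂ B) (h ▸ Algebra.mem_top)


/-! ### Perturbing generators along entire curves. -/

theorem exists_entire_lift {B : Type*} [NonUnitalCStarAlgebra B] {f g : ℂ → B}
    (hf : Differentiable ℂ f) (hg : Differentiable ℂ g) (t₀ : ℂ) {b : B}
    (hb : b ∈ NonUnitalAlgebra.adjoin ℂ {f t₀, g t₀}) :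
    ∃ h : ℂ → B, Differentiable ℂ h ∧ h t₀ = b ∧
      ∀ t, h t ∈ NonUnitalAlgebra.adjoin ℂ {f t, g t} := by
  induction hb using NonUnitalAlgebra.adjoin_induction with
  | mem x hx =>
    rcases hx with rfl | rfl
    · exact ⟨f, hf, rfl, fun t => NonUnitalAlgebra.subset_adjoin ℂ (by simp)⟩
    · exact ⟨g, hg, rfl, fun t => NonUnitalAlgebra.subset_adjoin ℂ (by simp)⟩
  | add x y _ _ hx hy =>
    obtain ⟨h, hd, rfl, hm⟩ := hx
    obtain ⟨k, kd, rfl, km⟩ := hy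
    exact ⟨fun t => h t + k t, hd.add kd, rfl, fun t => add_mem (hm t) (km t)⟩
  | zero => exact ⟨fun _ => 0, differentiable_const _, rfl, fun t => zero_mem _⟩
  | mul x y _ _ hx hy =>
    obtain ⟨h, hd, rfl, hm⟩ := hx
    obtain ⟨k, kd, rfl, km⟩ := hy
    refine ⟨fun t => h t * k t, fun t => ?_, rfl, fun t => mul_mem (hm t) (km t)⟩
    exact ((ContinuousLinearMap.mul ℂ B).hasFDerivAt_of_bilinear
      (hd t).hasFDerivAt (kd t).hasFDerivAt).differentiableAt
  | smul r x _ hx =>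
    obtain ⟨h, hd, rfl, hm⟩ := hx
    exact ⟨fun t => r • h t, hd.const_smul r, rfl, fun t => SMulMemClass.smul_mem r (hm t)⟩

/-- Lift a basis from `t₀` to entire curves in the generated algebras; its determinant is entire and
nonzero at `t₀`, so its zeros are isolated. -/
theorem eventually_adjoin_eq_top {B : Type*} [NonUnitalCStarAlgebra B] [FiniteDimensional ℂ B]
    {f g : ℂ → B} (hf : Differentiable ℂ f) (hg : Differentiable ℂ g) {t₀ : ℂ}
    (h₀ : NonUnitalAlgebra.adjoin ℂ {f t₀, g t₀} = ⊤) (z : ℂ) :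
    ∀ᶠ t in 𝓝[≠] z, NonUnitalAlgebra.adjoin ℂ {f t, g t} = ⊤ := by
  let e := Module.finBasis ℂ B
  have hlift (i) := exists_entire_lift hf hg t₀ (b := e i) (h₀ ▸ NonUnitalAlgebra.mem_top)
  choose h hd heq hm using hlift
  have hdet : Differentiable ℂ fun t => e.det fun i => h i t := by
    have hc (i j) : Differentiable ℂ fun t => e.repr (h j t) i :=
      ((LinearMap.toContinuousLinearMap (e.coord i)).differentiable).comp (hd j)
    simp only [Module.Basis.det_apply, Matrix.det_apply, Module.Basis.toMatrix_apply]
    fun_prop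
  have hne : e.det (fun i => h i t₀) ≠ 0 := by
    have : (fun i => h i t₀) = e := funext heq
    rw [this, e.det_self]
    exact one_ne_zero
  have hev : ∀ᶠ t in 𝓝[≠] z, e.det (fun i => h i t) ≠ 0 := by
    by_contra hcon
    rw [Filter.not_eventually] at hcon
    have han : AnalyticOnNhd ℂ (fun t => e.det fun i => h i t) Set.univ :=
      fun t _ => hdet.analyticAt t
    exact hne (han.eqOn_zero_of_preconnected_of_frequently_eq_zero isPreconnected_univ
      (Set.mem_univ z) (hcon.mono fun t ht => not_not.mp ht) (Set.mem_univ t₀))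
  filter_upwards [hev] with t ht
  have hspan := ((Module.Basis.is_basis_iff_det e).mpr (isUnit_iff_ne_zero.mpr ht)).2
  rw [← NonUnitalAlgebra.toSubmodule_eq_top, eq_top_iff, ← hspan, Submodule.span_le]
  rintro _ ⟨i, rfl⟩
  exact hm i t

theorem adjoin_selfAdjoint_pair {A : Type*} [NonUnitalCStarAlgebra A] (h k : selfAdjoint A) :
    NonUnitalStarAlgebra.adjoin ℂ {(h : A), (k : A)} =
      NonUnitalStarAlgebra.adjoin ℂ {(h : A) + Complex.I • (k : A)} := by
  apply le_antisymm
  · set c : A := (h : A) + Complex.I • (k : A)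
    have hre : realPart c = h := by simp [c, realPart_I_smul]
    have him : imaginaryPart c = k := by simp [c, imaginaryPart_I_smul]
    have hc := NonUnitalStarAlgebra.self_mem_adjoin_singleton ℂ c
    have hs := NonUnitalStarAlgebra.star_self_mem_adjoin_singleton ℂ c
    refine NonUnitalStarAlgebra.adjoin_le (Set.pair_subset ?_ ?_)
    · rw [← hre, realPart_apply_coe, ← Complex.coe_smul]
      exact SMulMemClass.smul_mem _ (add_mem hc hs)
    · rw [← him, imaginaryPart_apply_coe, ← Complex.coe_smul]
      exact SMulMemClass.smul_mem _ (SMulMemClass.smul_mem _ (sub_mem hc hs))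
  · refine NonUnitalStarAlgebra.adjoin_le (Set.singleton_subset_iff.mpr ?_)
    exact add_mem (NonUnitalStarAlgebra.subset_adjoin ℂ _ (by simp))
      (SMulMemClass.smul_mem _ (NonUnitalStarAlgebra.subset_adjoin ℂ _ (by simp)))

theorem exists_real_adjoin_eq_top {B : Type*} [NonUnitalCStarAlgebra B] [FiniteDimensional ℂ B]
    {f g : ℂ → B} (hf : Differentiable ℂ f) (hg : Differentiable ℂ g) {t₀ : ℂ}
    (h₀ : NonUnitalAlgebra.adjoin ℂ {f t₀, g t₀} = ⊤) :
    ∃ᶠ t : ℝ in 𝓝 0, NonUnitalAlgebra.adjoin ℂ {f t, g t} = ⊤ := by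
  have h := eventually_adjoin_eq_top hf hg h₀ 0
  have ht : Tendsto (fun t : ℝ => (t : ℂ)) (𝓝[≠] 0) (𝓝[≠] 0) := by
    refine tendsto_nhdsWithin_of_tendsto_nhds_of_eventually_within _ ?_ ?_
    · exact (Complex.continuous_ofReal.tendsto' 0 0 (by simp)).mono_left nhdsWithin_le_nhds
    · filter_upwards [self_mem_nhdsWithin] with t ht
      simpa using ht
  exact (ht.eventually h).frequently.filter_mono nhdsWithin_le_nhds

theorem exists_selfAdjoint_adjoin_pair (B : Type*) [NonUnitalCStarAlgebra B]
    [FiniteDimensional ℂ B] :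
    ∃ x y : selfAdjoint B, NonUnitalAlgebra.adjoin ℂ {(x : B), (y : B)} = ⊤ := by
  obtain ⟨x, y, h⟩ := exists_nonUnital_adjoin_pair B
  rw [← realPart_add_I_smul_imaginaryPart x, ← realPart_add_I_smul_imaginaryPart y] at h
  -- At `z = I` the curves give `x` and `y`; at real `z` they are self-adjoint.
  obtain ⟨t, ht⟩ := (exists_real_adjoin_eq_top
    (f := fun z => (realPart x : B) + z • (imaginaryPart x : B))
    (g := fun z => (realPart y : B) + z • (imaginaryPart y : B)) (by fun_prop) (by fun_prop)
    h).exists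
  exact ⟨realPart x + t • imaginaryPart x, realPart y + t • imaginaryPart y, by simpa using ht⟩

/-- In a finite-dimensional C⋆-algebra the single generators are dense. -/
theorem dense_adjoin_singleton_eq_top (B : Type*) [NonUnitalCStarAlgebra B]
    [FiniteDimensional ℂ B] : Dense {b : B | NonUnitalStarAlgebra.adjoin ℂ {b} = ⊤} := by
  intro b
  obtain ⟨x, y, h⟩ := exists_selfAdjoint_adjoin_pair B
  set p : selfAdjoint B := realPart b
  set q : selfAdjoint B := imaginaryPart b
  -- The line runs from the parts of `b` at 0 to a generating pair at 1.
  have hfreq := exists_real_adjoin_eq_top (t₀ := 1)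
    (f := fun z => (p : B) + z • ((x : B) - p)) (g := fun z => (q : B) + z • ((y : B) - q))
    (by fun_prop) (by fun_prop) (by simpa using h)
  let c : ℝ → B := fun t => ((p : B) + (t : ℂ) • ((x : B) - p)) +
    Complex.I • ((q : B) + (t : ℂ) • ((y : B) - q))
  have hc : Tendsto c (𝓝 0) (𝓝 b) := by
    refine Continuous.tendsto' (by fun_prop) _ _ ?_
    simpa [c] using realPart_add_I_smul_imaginaryPart b
  refine mem_closure_of_frequently_of_tendsto (hfreq.mono fun t ht => ?_) hc
  have hc' : c t = ((p + t • (x - p) : selfAdjoint B) : B) +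
    Complex.I • ((q + t • (y - q) : selfAdjoint B) : B) := by simp [c]
  rw [Set.mem_ofPred_eq, hc', ← adjoin_selfAdjoint_pair, eq_top_iff]
  intro z _
  have hz : z ∈ NonUnitalAlgebra.adjoin ℂ
      {((p + t • (x - p) : selfAdjoint B) : B), ((q + t • (y - q) : selfAdjoint B) : B)} := by
    have : z ∈ (⊤ : NonUnitalSubalgebra ℂ B) := NonUnitalAlgebra.mem_top
    rw [← ht] at this
    simpa using this
  exact NonUnitalAlgebra.adjoin_le (NonUnitalStarAlgebra.subset_adjoin ℂ _)
    (S := (NonUnitalStarAlgebra.adjoin ℂ _).toNonUnitalSubalgebra) hz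


/-! ### Single generators as a countable intersection of dense open sets. -/

theorem generatedBy_eq_top_iff {A : Type*} [NonUnitalCStarAlgebra A] (s : Set A) :
    generatedBy s = ⊤ ↔ Dense (NonUnitalStarAlgebra.adjoin ℂ s : Set A) := by
  rw [← SetLike.coe_set_eq, dense_iff_closure_eq]
  rfl

/-- A ⋆-polynomial in `a` varies continuously with `a`; this makes `approxGen` open. -/
theorem exists_continuous_lift {A : Type*} [NonUnitalCStarAlgebra A] {a x : A}
    (hx : x ∈ NonUnitalStarAlgebra.adjoin ℂ {a}) :
    ∃ f : A → A, Continuous f ∧ f a = x ∧ ∀ b, f b ∈ NonUnitalStarAlgebra.adjoin ℂ {b} := by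
  induction hx using NonUnitalStarAlgebra.adjoin_induction with
  | mem x hx =>
    obtain rfl : x = a := hx
    exact ⟨id, continuous_id, rfl, fun b => NonUnitalStarAlgebra.self_mem_adjoin_singleton ℂ b⟩
  | add x y _ _ hx hy =>
    obtain ⟨f, hf, rfl, hfm⟩ := hx
    obtain ⟨g, hg, rfl, hgm⟩ := hy
    exact ⟨fun b => f b + g b, hf.add hg, rfl, fun b => add_mem (hfm b) (hgm b)⟩
  | zero => exact ⟨fun _ => 0, continuous_const, rfl, fun b => zero_mem _⟩
  | mul x y _ _ hx hy =>
    obtain ⟨f, hf, rfl, hfm⟩ := hx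
    obtain ⟨g, hg, rfl, hgm⟩ := hy
    exact ⟨fun b => f b * g b, hf.mul hg, rfl, fun b => mul_mem (hfm b) (hgm b)⟩
  | smul r x _ hx =>
    obtain ⟨f, hf, rfl, hfm⟩ := hx
    exact ⟨fun b => r • f b, hf.const_smul r, rfl, fun b => SMulMemClass.smul_mem r (hfm b)⟩
  | star x _ hx =>
    obtain ⟨f, hf, rfl, hfm⟩ := hx
    exact ⟨fun b => star (f b), hf.star, rfl, fun b => star_mem (hfm b)⟩

/-- The elements `a` for which the ⋆-algebra generated by `a` meets the `ε`-ball around `d`. -/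
def approxGen {A : Type*} [NonUnitalCStarAlgebra A] (d : A) (ε : ℝ) : Set A :=
  {a | ∃ x ∈ NonUnitalStarAlgebra.adjoin ℂ {a}, dist d x < ε}

theorem isOpen_approxGen {A : Type*} [NonUnitalCStarAlgebra A] (d : A) (ε : ℝ) :
    IsOpen (approxGen d ε) := by
  rw [isOpen_iff_mem_nhds]
  rintro a ⟨x, hx, hdx⟩
  obtain ⟨f, hf, rfl, hfm⟩ := exists_continuous_lift hx
  have : ∀ᶠ b in 𝓝 a, dist d (f b) < ε :=
    (continuous_const.dist hf).continuousAt.eventually_lt_const hdx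
  exact this.mono fun b hb => ⟨f b, hfm b, hb⟩

theorem setOf_generator_eq_iInter {A : Type*} [NonUnitalCStarAlgebra A] {u : ℕ → A}
    (hu : DenseRange u) :
    {a : A | generatedBy {a} = ⊤} = ⋂ p : ℕ × ℕ, approxGen (u p.1) (1 / (p.2 + 1 : ℝ)) := by
  ext a
  simp only [Set.mem_ofPred_eq, Set.mem_iInter, Prod.forall, generatedBy_eq_top_iff]
  constructor
  · intro h n m
    exact h.exists_dist_lt (u n) Nat.one_div_pos_of_nat
  · intro h
    rw [Metric.dense_iff]
    intro d r hr
    obtain ⟨m, hm⟩ := exists_nat_one_div_lt (half_pos hr)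
    obtain ⟨n, hn⟩ := hu.exists_dist_lt d (half_pos hr)
    obtain ⟨x, hx, hdx⟩ := h n m
    refine ⟨x, ?_, hx⟩
    rw [Metric.mem_ball, dist_comm]
    linarith [dist_triangle d (u n) x]

theorem dense_approxGen {A : Type*} [NonUnitalCStarAlgebra A] (hA : IsAF A) (d : A) {ε : ℝ}
    (hε : 0 < ε) : Dense (approxGen d ε) := by
  obtain ⟨F, hF, hfin, hdense⟩ := hA
  rw [Metric.dense_iff]
  intro a r hr
  obtain ⟨a', ha', haa'⟩ := hdense.exists_dist_lt a (half_pos hr)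
  obtain ⟨d', hd', hdd'⟩ := hdense.exists_dist_lt d hε
  simp only [Set.mem_iUnion, SetLike.mem_coe, exists_prop] at ha' hd'
  obtain ⟨B₁, hB₁, ha'⟩ := ha'
  obtain ⟨B₂, hB₂, hd'⟩ := hd'
  -- One `B` contains approximants of both `a` and `d`, so a generator of `B` near `a'` has `d'` in
  -- its ⋆-algebra.
  obtain ⟨B, hB, h₁, h₂⟩ := hF B₁ hB₁ B₂ hB₂
  have := hfin B hB
  have : IsClosed (B : Set A) :=
    Submodule.closed_of_finiteDimensional (B.toNonUnitalSubalgebra.toSubmodule)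
  obtain ⟨b, hb, hab⟩ := (dense_adjoin_singleton_eq_top B).exists_dist_lt ⟨a', h₁ ha'⟩ (half_pos hr)
  refine ⟨b, ?_, d', ?_, hdd'⟩
  · rw [Metric.mem_ball, dist_comm]
    have : dist a' b < r / 2 := hab
    linarith [dist_triangle a a' b]
  · have hmem : (⟨d', h₂ hd'⟩ : B) ∈ NonUnitalStarAlgebra.adjoin ℂ {b} := by
      rw [hb]; exact NonUnitalStarAlgebra.mem_top
    let i : B →⋆ₙₐ[ℂ] A := NonUnitalStarSubalgebraClass.subtype B
    have h : d' ∈ (NonUnitalStarAlgebra.adjoin ℂ {b}).map i := ⟨_, hmem, rfl⟩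
    rwa [NonUnitalStarAlgHom.map_adjoin_singleton] at h

theorem isGδ_generator (A : Type*) [NonUnitalCStarAlgebra A]
    [TopologicalSpace.SeparableSpace A] : IsGδ {a : A | generatedBy {a} = ⊤} := by
  rw [setOf_generator_eq_iInter (TopologicalSpace.denseRange_denseSeq A)]
  exact IsGδ.iInter_of_isOpen fun p => isOpen_approxGen _ _

theorem dense_generator {A : Type*} [NonUnitalCStarAlgebra A]
    [TopologicalSpace.SeparableSpace A] (hA : IsAF A) :
    Dense {a : A | generatedBy {a} = ⊤} := by
  rw [setOf_generator_eq_iInter (TopologicalSpace.denseRange_denseSeq A)]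
  exact dense_iInter_of_isOpen (fun p => isOpen_approxGen _ _)
    fun p => dense_approxGen hA _ Nat.one_div_pos_of_nat

/-! ### Generator rank and passage to the unitization. -/

theorem dense_genSA_two {A : Type*} [NonUnitalCStarAlgebra A]
    [TopologicalSpace.SeparableSpace A] (hA : IsAF A) : Dense (genSA A 2) := by
  let φ : A → Fin 2 → selfAdjoint A := fun a => ![realPart a, imaginaryPart a]
  have hφ : Continuous φ := by
    refine continuous_pi fun i => ?_
    fin_cases i
    · refine Continuous.subtype_mk (f := fun a : A => (realPart a : A)) ?_ _
      simp only [realPart_apply_coe]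
      fun_prop
    · refine Continuous.subtype_mk (f := fun a : A => (imaginaryPart a : A)) ?_ _
      simp only [imaginaryPart_apply_coe]
      fun_prop
  have hsurj : Function.Surjective φ := fun v => by
    refine ⟨(v 0 : A) + Complex.I • (v 1 : A), ?_⟩
    funext i
    fin_cases i <;> simp [φ, realPart_I_smul, imaginaryPart_I_smul]
  refine (hsurj.denseRange.dense_image hφ (dense_generator hA)).mono ?_
  rintro _ ⟨a, ha, rfl⟩
  have hrange : (Set.range fun i => (φ a i : A)) = {(realPart a : A), (imaginaryPart a : A)} := by
    ext x
    simp [φ, Fin.exists_fin_two, eq_comm]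
  change generatedBy _ = ⊤
  rw [hrange, generatedBy, adjoin_selfAdjoint_pair, realPart_add_I_smul_imaginaryPart]
  exact ha

theorem grSA_le_one {A : Type*} [NonUnitalCStarAlgebra A]
    [TopologicalSpace.SeparableSpace A] (hA : IsAF A) : grSA A ≤ 1 :=
  sInf_le ⟨1, by simp, dense_genSA_two hA⟩

/-- The preimage of a ⋆-subalgebra under the projection of the unitization: its unitization inside
the unitization of the ambient algebra. -/
def unitizationSubalgebra {A : Type*} [NonUnitalCStarAlgebra A]
    (B : NonUnitalStarSubalgebra ℂ A) : NonUnitalStarSubalgebra ℂ (Unitization ℂ A) where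
  carrier := {x | x.snd ∈ B}
  add_mem' hx hy := by simpa using add_mem hx hy
  zero_mem' := by simp
  mul_mem' hx hy := by
    rw [Set.mem_ofPred_eq, Unitization.snd_mul]
    exact add_mem (add_mem (SMulMemClass.smul_mem _ hy) (SMulMemClass.smul_mem _ hx))
      (mul_mem hx hy)
  smul_mem' c x hx := by simpa using SMulMemClass.smul_mem c hx
  star_mem' hx := by simpa using star_mem hx

theorem IsAF.unitization {A : Type*} [NonUnitalCStarAlgebra A] (hA : IsAF A) :
    IsAF (Unitization ℂ A) := by
  obtain ⟨F, hF, hfin, hdense⟩ := hA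
  refine ⟨unitizationSubalgebra '' F, ?_, ?_, ?_⟩
  · rintro _ ⟨B₁, hB₁, rfl⟩ _ ⟨B₂, hB₂, rfl⟩
    obtain ⟨B, hB, h₁, h₂⟩ := hF B₁ hB₁ B₂ hB₂
    exact ⟨_, ⟨B, hB, rfl⟩, fun x hx => h₁ hx, fun x hx => h₂ hx⟩
  · rintro _ ⟨B, hB, rfl⟩
    have := hfin B hB
    let f : unitizationSubalgebra B →ₗ[ℂ] ℂ × B :=
      { toFun := fun x => (x.1.fst, ⟨x.1.snd, x.2⟩)
        map_add' := fun x y => rfl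
        map_smul' := fun c x => rfl }
    refine FiniteDimensional.of_injective f fun x y h => Subtype.ext (Unitization.ext ?_ ?_)
    · exact (Prod.ext_iff.mp h).1
    · exact congrArg (fun z : ℂ × B => (z.2 : A)) h
  · have h := (dense_univ (X := ℂ)).prod hdense
    have h' := Unitization.uniformEquivProd (𝕜 := ℂ) (A := A) |>.symm.surjective.denseRange.dense_image
      Unitization.uniformEquivProd.symm.continuous h
    refine h'.mono ?_
    rintro _ ⟨⟨c, a⟩, ⟨-, ha⟩, rfl⟩
    simp only [Set.mem_iUnion, SetLike.mem_coe, exists_prop] at ha ⊢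
    obtain ⟨B, hB, ha⟩ := ha
    exact ⟨_, ⟨B, hB, rfl⟩, ha⟩

theorem generatorRank_le_one {A : Type*} [NonUnitalCStarAlgebra A]
    [TopologicalSpace.SeparableSpace A] (hA : IsAF A) : generatorRank A ≤ 1 := by
  rw [generatorRank]
  split_ifs
  · exact grSA_le_one hA
  · have : TopologicalSpace.SeparableSpace (Unitization ℂ A) :=
      (Unitization.uniformEquivProd (𝕜 := ℂ) (A := A)).symm.surjective.denseRange.separableSpace
        Unitization.uniformEquivProd.symm.continuous
    exact grSA_le_one hA.unitization

end CStarGen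

theorem mainTheorem4 {A : Type*} [NonUnitalCStarAlgebra A] [TopologicalSpace.SeparableSpace A]
    (hA : CStarGen.IsAF A) :
    CStarGen.generatorRank A ≤ 1 ∧
      IsGδ {a : A | CStarGen.generatedBy {a} = ⊤} ∧
      Dense {a : A | CStarGen.generatedBy {a} = ⊤} :=
  ⟨CStarGen.generatorRank_le_one hA, CStarGen.isGδ_generator A, CStarGen.dense_generator hA⟩
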